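/- Let $\lambda$ be a cardinal (identified with the set of ordinals below it), let $\mathcal U$ be a selective ultrafilter on $\omega$, and let $G=\mathbb Q^{(\lambda)}$ be the group of finitely supported functions $\lambda\to\mathbb Q$; for $\mu<\lambda$ let $\chi_\mu\in G$ be the function with value $1$ at $\mu$ and $0$ elsewhere, and for $E\subseteq\lambda$ let $\mathbb Q^{(E)}=\{a\in G:\operatorname{supp} a\subseteq E\}$. Let $\mathrm{Ult}_{\mathcal U}(G)$ be the ultrapower of $G$ by $\mathcal U$ (the quotient of $G^\omega$ by equality on a member of $\mathcal U$), a $\mathbb Q$-vector space, and write $[g]_{\mathcal U}$ for the class of $g\in G^\omega$. Let $\mathcal H\subseteq G^\omega$ be such that the family $([g]_{\mathcal U})_{g\in\mathcal H}$ together with the classes of the constant sequences with value $\chi_\mu$ ($\mu<\lambda$) is a $\mathbb Q$-basis of $\mathrm{Ult}_{\mathcal U}(G)$. Let $\mathcal G\subseteq\mathcal H$ be countable and $B\in\mathcal U$. Let $\mathcal H'$ be a finite subset of $\mathcal G$ and $(r_g)_{g\in\mathcal H'}$ a family of rational numbers, not all equal to $0$. Let $E\subseteq\lambda$ be countably infinite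 with $\omega\cup\bigcup_{g\in\mathcal G,\,n\in\omega}\operatorname{supp} g(n)\subseteq E$, and let $(\xi_g)_{g\in\mathcal G}$ be a family of elements of $\mathfrak c\cap E$. Then there exists a group homomorphism $\phi:\mathbb Q^{(E)}\to\mathbb T=\mathbb R/\mathbb Z$ such that (a) $\mathcal U\text{-}\lim_{n}\,\phi\bigl(\tfrac1N g(n)\bigr)=\phi\bigl(\tfrac1N\chi_{\xi_g}\bigr)$ for every $g\in\mathcal G$ and every integer $N\ge 1$, and (b) the sequence $\bigl(\phi\bigl(\sum_{g\in\mathcal H'}r_g\,g(n)\bigr):n\in B\bigr)$ does not converge in $\mathbb T$. -/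

import Mathlib

open Filter Topology

universe u

/-- The cardinal `κ`, regarded as the set of all ordinals below its initial ordinal. -/
abbrev Below (κ : Cardinal.{u}) : Type (u + 1) := {α : Ordinal.{u} // α < κ.ord}

/-- The group `G = ℚ^(κ)` of the finitely supported functions from `κ` to `ℚ`. For `E ⊆ κ`, its
subgroup `ℚ^(E)` is `Finsupp.supported ℚ ℚ E`. -/
abbrev RatSum (κ : Cardinal.{u}) : Type (u + 1) := Below κ →₀ ℚ

/-- The element `χ_μ` of `ℚ^(κ)`: it is `1` at `μ` and `0` elsewhere. -/
noncomputable def chi {κ : Cardinal.{u}} (μ : Below κ) : RatSum κ := Finsupp.single μ 1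

/-- A selective ultrafilter on `ω`: it is nonprincipal, and for every partition of `ω` (here into
the fibres of `f`) whose pieces do not belong to `U`, some member of `U` meets each piece in at
most one point. -/
structure IsSelectiveUltrafilter (U : Ultrafilter ℕ) : Prop where
  nonprincipal : ∀ n : ℕ, U ≠ pure n
  selective : ∀ f : ℕ → ℕ, (∀ k, f ⁻¹' {k} ∉ U) → ∃ A ∈ U, Set.InjOn f A

/-- The ultrapower `Ult_U(ℚ^(κ))`, with its structure of a `ℚ`-vector space. -/
abbrev Ult (U : Ultrafilter ℕ) (κ : Cardinal.{u}) : Type (u + 1) :=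
  Filter.Germ (U : Filter ℕ) (RatSum κ)

/-- The class `[g]_U` of a sequence in the ultrapower. -/
def ultClass (U : Ultrafilter ℕ) {κ : Cardinal.{u}} (g : ℕ → RatSum κ) : Ult U κ :=
  (g : Filter.Germ (U : Filter ℕ) (RatSum κ))

/-- The family consisting of the `[g]_U`, `g ∈ H`, together with the classes of the constant
sequences `χ_μ`, `μ < κ`. -/
noncomputable def ultFamily (U : Ultrafilter ℕ) {κ : Cardinal.{u}} (H : Set (ℕ → RatSum κ)) :
    H ⊕ Below κ → Ult U κ :=
  Sum.elim (fun g => ultClass U (g : ℕ → RatSum κ)) (fun μ => ultClass U (fun _ => chi μ))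

/-- The family `ultFamily U H` is a basis of the `ℚ`-vector space `Ult_U(ℚ^(κ))`. -/
def IsUltBasis (U : Ultrafilter ℕ) {κ : Cardinal.{u}} (H : Set (ℕ → RatSum κ)) : Prop :=
  LinearIndependent ℚ (ultFamily U H) ∧ Submodule.span ℚ (Set.range (ultFamily U H)) = ⊤

theorem smul_mem_supported {κ : Cardinal.{u}} {E : Set (Below κ)} {a : RatSum κ}
    (ha : (a.support : Set (Below κ)) ⊆ E) (q : ℚ) : q • a ∈ Finsupp.supported ℚ ℚ E :=
  Submodule.smul_mem _ q ((Finsupp.mem_supported ℚ a).2 ha)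

theorem smul_chi_mem_supported {κ : Cardinal.{u}} {E : Set (Below κ)} {μ : Below κ}
    (hμ : μ ∈ E) (q : ℚ) : q • chi μ ∈ Finsupp.supported ℚ ℚ E :=
  Submodule.smul_mem _ q (Finsupp.single_mem_supported ℚ 1 hμ)

theorem sum_smul_mem_supported {κ : Cardinal.{u}} {E : Set (Below κ)} {ι : Type*}
    (s : Finset ι) (r : ι → ℚ) (a : ι → RatSum κ)
    (ha : ∀ i, ((a i).support : Set (Below κ)) ⊆ E) :
    ∑ i ∈ s, r i • a i ∈ Finsupp.supported ℚ ℚ E :=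
  Submodule.sum_mem _ fun i _ => smul_mem_supported (ha i) (r i)

/-!
The homomorphism `φ` is the pointwise limit of homomorphisms `φ_k` from `X = ℚ^(E)` to the circle,
each of which differs little from the preceding one on a finite set, these sets exhausting the
countable group `X`.

The basis of the ultrapower provides a linear retraction `L` of the ultrapower of `X` onto the
constants that sends the class of `g / N` to `χ_{ξ g} / N`. Then `φ_k ∘ L` is a homomorphism on the
ultrapower that extends `φ_k`, and such a homomorphism can be approximated, on finitely many
classes, by homomorphisms on almost all factors (`eventually_exists_addMonoidHom_dist_lt`). So for
`U`-almost every `n` there is a `φ_{k+1}` close to `φ_k` on a given finite set whose values at `g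
n/N`, for finitely many `g` and `N`, are close to those at `χ_{ξ g} / N`. To prevent convergence on
`B`, one first passes to a homomorphism that at some `h m`, with `h = ∑ r_g g` and `m ∈ B` large,
is close to the value at `L h` plus `1/2`; this uses that the class of `h` is not constant, so that
some homomorphism on the ultrapower kills the constants and is `1/2` at `h`. In the end `φ ∘ h` has
two different cluster points on `B`, one of them being its limit along `U`.

The approximation rests on a form of Kronecker's theorem
(`exists_finset_forall_addSubmonoid_inter`): the values of homomorphisms at finitely many elements
of a torsion-free divisible group meet a given nonempty open subset of the torus as soon as
finitely many integer relations between these elements, depending only on the open set, fail.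

For the limits along `U` the numbers `n` used in the steps have to form a member of `U`. This is
where selectivity enters: no choice of admissible sets, in response to the numbers used before, can
prevent it (`IsSelectiveUltrafilter.exists_run`).
-/

/-! ### Open subsets of the torus and characters -/

theorem mFourier_sum_apply {d ι : Type*} [Fintype d] (r : d → ℤ) (s : Finset ι)
    (c : ι → UnitAddTorus d) :
    UnitAddTorus.mFourier r (∑ i ∈ s, c i) = ∏ i ∈ s, UnitAddTorus.mFourier r (c i) := by
  simp only [UnitAddTorus.mFourier, ContinuousMap.coe_mk]
  rw [Finset.prod_comm]
  refine Finset.prod_congr rfl fun j _ => ?_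
  rw [Finset.sum_apply]
  induction s using Finset.cons_induction with
  | empty => simp
  | cons i s hi ih => rw [Finset.sum_cons, Finset.prod_cons, ← ih]; simp [fourier_apply,
      AddCircle.toCircle_add]

/-- A character of the torus that takes the value `-1` has integral `0`, since translation by such
a point changes the sign of the integral. -/
theorem integral_mFourier_eq_zero {d : Type*} [Fintype d] {r : d → ℤ} {c : UnitAddTorus d}
    (hc : UnitAddTorus.mFourier r c = -1) : ∫ x, UnitAddTorus.mFourier r x = 0 := by
  have h := MeasureTheory.integral_add_right_eq_self (μ := MeasureTheory.volume)
    (fun x => UnitAddTorus.mFourier r x) c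
  have h2 : ∀ x, UnitAddTorus.mFourier r (x + c) = -UnitAddTorus.mFourier r x := by
    intro x
    have := mFourier_sum_apply r Finset.univ ![x, c]
    simpa [Fin.sum_univ_two, Fin.prod_univ_two, hc] using this
  simp only [h2, MeasureTheory.integral_neg] at h
  exact self_eq_neg.mp h.symm

/-- A form of Kronecker's theorem: a submonoid `D` of the torus meets a given nonempty open set `W`
as soon as each of finitely many nonzero characters, which depend on `W` alone, takes the value
`-1` somewhere on `D`.

A bump function `f` supported in `W` is approximated uniformly by a trigonometric polynomial `P`,
and the characters are those that occur in `P`. If `c r ∈ D` is a point where the character `r` is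
`-1`, then averaging over the sums of subsets of `{c r}` kills each nonconstant character, because
the average is a product with the factor `(1 + (-1)) / 2`. So the average of `P` over these points
of `D` is the constant term of `P`, as is its integral; as `f` has a positive integral, it cannot
vanish on `D`. -/
theorem exists_finset_forall_addSubmonoid_inter {d : Type*} [Fintype d]
    {W : Set (UnitAddTorus d)} (hW : IsOpen W) (hne : W.Nonempty) :
    ∃ S : Finset (d → ℤ), (∀ r ∈ S, r ≠ 0) ∧ ∀ D : AddSubmonoid (UnitAddTorus d),
      (∀ r ∈ S, ∃ c ∈ D, UnitAddTorus.mFourier r c = -1) → ((D : Set _) ∩ W).Nonempty := by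
  classical
  obtain ⟨w, hw⟩ := hne
  obtain ⟨f, hf0, hf1, hf⟩ := exists_continuous_zero_one_of_isClosed (s := Wᶜ) (t := {w})
    hW.isClosed_compl isClosed_singleton (by simpa using hw)
  set I : ℝ := ∫ x, f x with hI
  have hIpos : 0 < I := by
    rw [hI]
    refine (MeasureTheory.integral_pos_iff_support_of_nonneg (fun x => (hf x).1) ?_).2 ?_
    · exact f.continuous.integrable_of_hasCompactSupport (HasCompactSupport.of_compactSpace _)
    · refine (f.continuous.isOpen_support).measure_pos _ ⟨w, ?_⟩
      have : f w = 1 := hf1 rfl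
      simp [this]
  set V : ℝ := MeasureTheory.volume.real (Set.univ : Set (UnitAddTorus d)) with hV
  have hV0 : 0 ≤ V := MeasureTheory.measureReal_nonneg
  let F : C(UnitAddTorus d, ℂ) := ⟨fun x => (f x : ℂ), by fun_prop⟩
  -- `δ` is the precision of the approximation; the errors of average and integral add up to `2δV`
  obtain ⟨δ, hδ, hδI⟩ : ∃ δ : ℝ, 0 < δ ∧ 2 * δ * V < I := by
    refine ⟨I / (2 * V + 1), by positivity, ?_⟩
    rw [mul_div_assoc', div_mul_eq_mul_div, div_lt_iff₀ (by positivity)]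
    nlinarith
  have hF : F ∈ (Submodule.span ℂ (Set.range (UnitAddTorus.mFourier (d := d)))).topologicalClosure
      := by rw [UnitAddTorus.span_mFourier_closure_eq_top]; trivial
  obtain ⟨P, hP, hFP⟩ := Metric.mem_closure_iff.1 hF δ hδ
  obtain ⟨a, rfl⟩ := Finsupp.mem_span_range_iff_exists_finsupp.1 hP
  refine ⟨a.support.erase 0, fun r hr => (Finset.mem_erase.1 hr).1, fun D hD => ?_⟩
  by_contra hempty
  have hfD : ∀ x ∈ D, f x = 0 := fun x hx => hf0 fun hxW => hempty ⟨x, hx, hxW⟩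
  choose! c hcD hc using hD
  set S := a.support.erase 0
  set P : C(UnitAddTorus d, ℂ) := a.sum fun r b => b • UnitAddTorus.mFourier r with hPdef
  have hPx : ∀ x, P x = ∑ r ∈ a.support, a r * UnitAddTorus.mFourier r x := by
    intro x
    simp [hPdef, Finsupp.sum]
  have hdist : ∀ x, ‖F x - P x‖ ≤ δ := fun x => by
    rw [← dist_eq_norm]; exact (ContinuousMap.dist_apply_le_dist x).trans hFP.le
  -- the sum of `P` over the subset sums of the `c r`
  have hsum : ∑ T ∈ S.powerset, P (∑ r ∈ T, c r) = 2 ^ S.card * a 0 := by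
    simp only [hPx]
    rw [Finset.sum_comm]
    have key : ∀ r, ∑ T ∈ S.powerset, a r * UnitAddTorus.mFourier r (∑ s ∈ T, c s) =
        a r * ∏ s ∈ S, (1 + UnitAddTorus.mFourier r (c s)) := by
      intro r
      rw [Finset.prod_one_add, ← Finset.mul_sum]
      simp only [mFourier_sum_apply]
    rw [Finset.sum_congr rfl fun r _ => key r, Finset.sum_eq_single 0]
    · simp [UnitAddTorus.mFourier_zero]
      norm_num [mul_comm]
    · intro r hr hr0
      rw [Finset.prod_eq_zero (i := r) (Finset.mem_erase.2 ⟨hr0, hr⟩), mul_zero]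
      rw [hc r (Finset.mem_erase.2 ⟨hr0, hr⟩)]; ring
    · intro h0
      simp [Finsupp.notMem_support_iff.1 h0]
  have ha0 : ‖a 0‖ ≤ δ := by
    have h1 : ‖∑ T ∈ S.powerset, P (∑ r ∈ T, c r)‖ ≤ 2 ^ S.card * δ := by
      have hle : ∀ T ∈ S.powerset, ‖P (∑ r ∈ T, c r)‖ ≤ δ := fun T hT => by
        have h0 : F (∑ r ∈ T, c r) = 0 := by
          have := hfD (∑ r ∈ T, c r) (sum_mem fun r hr => hcD r (Finset.mem_powerset.1 hT hr))
          simp [F, this]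
        simpa [h0] using hdist (∑ r ∈ T, c r)
      simpa using norm_sum_le_of_le _ hle
    rw [hsum, norm_mul] at h1
    have : ‖(2 ^ S.card : ℂ)‖ = 2 ^ S.card := by simp
    rw [this] at h1
    exact le_of_mul_le_mul_left h1 (by positivity)
  have hint : ∀ g : C(UnitAddTorus d, ℂ), MeasureTheory.Integrable g := fun g =>
    g.continuous.integrable_of_hasCompactSupport (HasCompactSupport.of_compactSpace _)
  have hPint : ∫ x, P x = V * a 0 := by
    simp only [hPx]
    rw [MeasureTheory.integral_finsetSum _ fun r _ => (hint _).const_mul _,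
      Finset.sum_eq_single 0]
    · simp [UnitAddTorus.mFourier_zero, hV, mul_comm]
    · intro r hr hr0
      rw [MeasureTheory.integral_const_mul,
        integral_mFourier_eq_zero (hc r (Finset.mem_erase.2 ⟨hr0, hr⟩)), mul_zero]
    · intro h0
      simp [Finsupp.notMem_support_iff.1 h0]
  have hFint : ∫ x, F x = (I : ℂ) := by
    simp only [F, ContinuousMap.coe_mk, hI]
    exact integral_ofReal
  have h2 : ‖(I : ℂ) - V * a 0‖ ≤ δ * V := by
    rw [← hFint, ← hPint, ← MeasureTheory.integral_sub (hint F) (hint P)]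
    exact MeasureTheory.norm_integral_le_of_norm_le_const (.of_forall hdist)
  have h3 : I ≤ δ * V + V * δ := by
    calc I = ‖(I : ℂ)‖ := by simp [abs_of_pos hIpos]
      _ = ‖((I : ℂ) - V * a 0) + V * a 0‖ := by ring_nf
      _ ≤ δ * V + V * δ := by
        refine (norm_add_le _ _).trans (add_le_add h2 ?_)
        rw [norm_mul, Complex.norm_real, Real.norm_of_nonneg hV0]
        gcongr
  linarith

/-! ### Homomorphisms from an ultrapower to the circle -/

/-- In a `ℚ`-vector space every nonzero element is sent to the element of order `2` by some
homomorphism to the circle. -/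
theorem exists_addMonoidHom_eq_half {X : Type*} [AddCommGroup X] [Module ℚ X] {x : X}
    (hx : x ≠ 0) : ∃ ψ : X →+ UnitAddCircle, ψ x = ((1 / 2 : ℝ) : UnitAddCircle) := by
  obtain ⟨l, hl⟩ := Module.Projective.exists_dual_ne_zero ℚ hx
  refine ⟨(QuotientAddGroup.mk' _).comp ((AddMonoidHom.mulLeft (1 / 2 : ℝ)).comp
    ((Rat.castHom ℝ).toAddMonoidHom.comp ((l x)⁻¹ • l).toAddMonoidHom)), ?_⟩
  have : ((l x)⁻¹ • l) x = 1 := by simp [hl]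
  change (((1 / 2 : ℝ) * ((((l x)⁻¹ • l) x : ℚ) : ℝ) : ℝ) : UnitAddCircle) = _
  rw [this]; simp

theorem mFourier_eq_toCircle_sum {d : Type*} [Fintype d] (r : d → ℤ) (x : UnitAddTorus d) :
    UnitAddTorus.mFourier r x = AddCircle.toCircle (∑ i, r i • x i) := by
  classical
  simp only [UnitAddTorus.mFourier, ContinuousMap.coe_mk, fourier_apply]
  induction (Finset.univ : Finset d) using Finset.cons_induction with
  | empty => simp
  | cons i s hi ih => rw [Finset.sum_cons, Finset.prod_cons, ih]; simp [AddCircle.toCircle_add]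

theorem coe_sum_zsmul {X ι : Type*} [AddCommGroup X] (l : Filter ℕ) (s : Finset ι) (a : ι → ℤ)
    (z : ι → ℕ → X) :
    ((fun n => ∑ j ∈ s, a j • z j n : ℕ → X) : Germ l X) = ∑ j ∈ s, a j • (z j : Germ l X) := by
  have h : (fun n => ∑ j ∈ s, a j • z j n) = ∑ j ∈ s, a j • z j := by ext n; simp
  rw [h]
  change Germ.coeAddHom l _ = ∑ j ∈ s, a j • Germ.coeAddHom l (z j)
  simp only [map_sum, map_zsmul]

/-- If the classes of finitely many sequences `z j` are independent in the ultrapower, then for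
`U`-almost all `n` the points `(ψ (z j n))_j`, `ψ` ranging over the homomorphisms to the circle,
meet a given open set of the torus: only finitely many integer relations between the `z j n` have
to be excluded, and each of them fails for `U`-almost all `n`. -/
theorem eventually_exists_addMonoidHom_mem {X : Type*} [AddCommGroup X] [Module ℚ X]
    {U : Ultrafilter ℕ} {d : Type*} [Fintype d] {z : d → ℕ → X}
    (hz : LinearIndependent ℤ fun j => (z j : Germ (U : Filter ℕ) X))
    {W : Set (UnitAddTorus d)} (hW : IsOpen W) (hne : W.Nonempty) :
    ∀ᶠ n in (U : Filter ℕ), ∃ ψ : X →+ UnitAddCircle, (fun j => ψ (z j n)) ∈ W := by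
  obtain ⟨S, hS0, hS⟩ := exists_finset_forall_addSubmonoid_inter hW hne
  have hev : ∀ᶠ n in (U : Filter ℕ), ∀ r ∈ S, ∑ j, r j • z j n ≠ 0 := by
    refine (Filter.eventually_all_finset S).2 fun r hr => ?_
    refine Ultrafilter.eventually_not.2 fun h => hS0 r hr ?_
    have h0 : ((fun n => ∑ j, r j • z j n : ℕ → X) : Germ (U : Filter ℕ) X) = 0 :=
      Germ.coe_eq.2 h
    rw [coe_sum_zsmul] at h0
    exact funext (Fintype.linearIndependent_iff.1 hz r h0)
  filter_upwards [hev] with n hn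
  let D : AddSubmonoid (UnitAddTorus d) := AddMonoidHom.mrange
    (AddMonoidHom.pi fun j => AddMonoidHom.eval (z j n) : (X →+ UnitAddCircle) →+ _)
  obtain ⟨_, ⟨ψ, rfl⟩, hψ⟩ := hS D fun r hr => by
    obtain ⟨ψ, hψ⟩ := exists_addMonoidHom_eq_half (hn r hr)
    refine ⟨_, ⟨ψ, rfl⟩, ?_⟩
    rw [mFourier_eq_toCircle_sum]
    have : ∑ i, r i • ψ (z i n) = ((1 / 2 : ℝ) : UnitAddCircle) := by
      rw [← hψ, map_sum]; simp
    change (AddCircle.toCircle (∑ i, r i • ψ (z i n)) : ℂ) = -1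
    rw [this, AddCircle.toCircle_apply_mk]
    have h2 : 2 * Real.pi / 1 * (1 / 2) = Real.pi := by ring
    rw [h2]; simp
  exact ⟨ψ, hψ⟩

/-- Every homomorphism `Φ` from the ultrapower of `X` to the circle is approximated, on finitely
many classes, by homomorphisms on `U`-almost all factors: the classes generate a free abelian group
of finite rank, whose basis is independent. -/
theorem eventually_exists_addMonoidHom_dist_lt {X : Type*} [AddCommGroup X] [Module ℚ X]
    {U : Ultrafilter ℕ} (Φ : Germ (U : Filter ℕ) X →+ UnitAddCircle) (s : Finset (ℕ → X))
    {ε : ℝ} (hε : 0 < ε) :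
    ∀ᶠ n in (U : Filter ℕ), ∃ ψ : X →+ UnitAddCircle,
      ∀ f ∈ s, dist (ψ (f n)) (Φ (f : Germ (U : Filter ℕ) X)) < ε := by
  classical
  let M : Submodule ℤ (Germ (U : Filter ℕ) X) :=
    Submodule.span ℤ (s.image (Germ.ofFun (l := (U : Filter ℕ))))
  have : Module.Finite ℤ M := Module.Finite.span_finset ℤ _
  have : Module.IsTorsionFree ℤ (Germ (U : Filter ℕ) X) :=
    Module.IsTorsionFree.trans_faithfulSMul ℤ ℚ _
  let b := Module.Free.chooseBasis ℤ M
  have hz : ∀ j, ∃ z : ℕ → X, (z : Germ (U : Filter ℕ) X) = b j := fun j =>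
    (b j : Germ (U : Filter ℕ) X).inductionOn fun f => ⟨f, rfl⟩
  choose z hz using hz
  have ha : ∀ f ∈ s, ∃ a : Module.Free.ChooseBasisIndex ℤ M → ℤ,
      (f : Germ (U : Filter ℕ) X) = ∑ j, a j • (b j : Germ (U : Filter ℕ) X) := by
    intro f hf
    have hfM : (f : Germ (U : Filter ℕ) X) ∈ M :=
      Submodule.subset_span (Finset.mem_coe.2 (Finset.mem_image_of_mem _ hf))
    refine ⟨b.repr ⟨_, hfM⟩, ?_⟩
    have := congrArg Subtype.val (b.sum_repr ⟨_, hfM⟩)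
    rw [Submodule.coe_sum] at this
    exact this.symm
  choose! a ha using ha
  let W : Set (UnitAddTorus (Module.Free.ChooseBasisIndex ℤ M)) :=
    {c | ∀ f ∈ s, dist (∑ j, a f j • c j) (Φ (f : Germ (U : Filter ℕ) X)) < ε}
  have hW : IsOpen W := by
    have : W = ⋂ f ∈ s, {c | dist (∑ j, a f j • c j) (Φ (f : Germ (U : Filter ℕ) X)) < ε} := by
      ext; simp [W]
    rw [this]
    refine isOpen_biInter_finset fun f _ => isOpen_lt (Continuous.dist ?_ continuous_const)
      continuous_const
    exact continuous_finsetSum _ fun j _ => (continuous_apply j).zsmul _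
  have hne : W.Nonempty := ⟨fun j => Φ (b j), fun f hf => by
    rw [ha f hf, map_sum]; simpa using hε⟩
  have hli : LinearIndependent ℤ fun j => (z j : Germ (U : Filter ℕ) X) := by
    simp only [hz]
    exact b.linearIndependent.map' M.subtype M.ker_subtype
  have hrel : ∀ᶠ n in (U : Filter ℕ), ∀ f ∈ s, f n = ∑ j, a f j • z j n := by
    refine (Filter.eventually_all_finset s).2 fun f hf => ?_
    have := ha f hf
    simp only [← hz] at this
    rw [← coe_sum_zsmul] at this
    exact Germ.coe_eq.1 this
  filter_upwards [hrel, eventually_exists_addMonoidHom_mem hli hW hne] with n hn hψ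
  obtain ⟨ψ, hψ⟩ := hψ
  refine ⟨ψ, fun f hf => ?_⟩
  rw [hn f hf, map_sum]
  simpa using hψ f hf

/-! ### Constructions along a selective ultrafilter -/

theorem IsSelectiveUltrafilter.le_cofinite {U : Ultrafilter ℕ} (hU : IsSelectiveUltrafilter U) :
    (U : Filter ℕ) ≤ cofinite :=
  U.le_cofinite_or_eq_pure.resolve_right fun ⟨n, hn⟩ => hU.nonprincipal n hn

theorem IsSelectiveUltrafilter.notMem_of_finite {U : Ultrafilter ℕ}
    (hU : IsSelectiveUltrafilter U) {s : Set ℕ} (hs : s.Finite) : s ∉ U :=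
  Ultrafilter.compl_mem_iff_notMem.1 (hU.le_cofinite hs.compl_mem_cofinite)

/-- Diagonalization for a selective ultrafilter: given `A m ∈ U`, some `C ∈ U` satisfies `n ∈ A m`
for all `m < n` in `C`. Selectivity is used twice: first to make almost all of `C` lie in each `A
m`, and then, for the partition of `ℕ` into sufficiently long intervals, to separate the elements
of `C`. -/
theorem IsSelectiveUltrafilter.exists_pairwise_mem {U : Ultrafilter ℕ}
    (hU : IsSelectiveUltrafilter U) (A : ℕ → Set ℕ) (hA : ∀ m, A m ∈ U) :
    ∃ C ∈ U, ∀ m ∈ C, ∀ n ∈ C, m < n → n ∈ A m := by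
  classical
  -- `f n` is the first index at which `n` leaves the decreasing sets `⋂ j ≤ k, A j ∩ (j, ∞)`,
  -- which belong to `U` and have empty intersection
  have hex : ∀ n, ∃ k, ∃ j ≤ k, n ∉ A j ∨ n ≤ j := fun n => ⟨n, n, le_rfl, Or.inr le_rfl⟩
  let f : ℕ → ℕ := fun n => Nat.find (hex n)
  have hfib : ∀ k, f ⁻¹' {k} ∉ U := by
    intro k hk
    have h1 : (⋂ j ∈ Set.Iic k, (A j ∩ Set.Ioi j)) ∈ (U : Filter ℕ) :=
      (biInter_mem (Set.finite_Iic k)).2 fun j _ =>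
        inter_mem (hA j) (hU.le_cofinite (by simp))
    obtain ⟨n, hn, hn'⟩ := U.nonempty_of_mem (inter_mem hk h1)
    obtain ⟨j, hj, h⟩ := Nat.find_spec (hex n)
    have hj' : j ≤ k := hj.trans (le_of_eq hn)
    have := Set.mem_iInter₂.1 hn' j hj'
    rcases h with h | h
    · exact h this.1
    · exact absurd this.2 (not_lt.2 h)
  obtain ⟨C₁, hC₁, hf⟩ := hU.selective f hfib
  have hbound : ∀ m, ∃ b, ∀ n ∈ C₁, b ≤ n → ∀ j ≤ m, n ∈ A j := by
    intro m
    have hfin : (C₁ ∩ f ⁻¹' Set.Iic m).Finite :=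
      Set.Finite.of_finite_image ((Set.finite_Iic m).subset (by rintro _ ⟨n, hn, rfl⟩; exact hn.2))
        (hf.mono Set.inter_subset_left)
    obtain ⟨b, hb⟩ := hfin.bddAbove
    refine ⟨b + 1, fun n hn hbn j hj => ?_⟩
    by_contra hnj
    have : f n ≤ m := (Nat.find_le_iff _ _).2 ⟨m, le_rfl, j, hj, Or.inl hnj⟩
    have := hb ⟨hn, this⟩
    omega
  choose b hb using hbound
  -- the endpoints of a partition of `ℕ` into intervals, so long that a point of `C₁` beyond the
  -- next interval lies in `A m` for every `m` of the present one
  let e : ℕ → ℕ := fun j => Nat.rec 0 (fun _ x => max (x + 1) (b x)) j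
  have he : ∀ j, e (j + 1) = max (e j + 1) (b (e j)) := fun _ => rfl
  have hmono : StrictMono e := strictMono_nat_of_lt_succ fun j => by rw [he]; omega
  -- `q n` is the index of the interval that contains `n`
  have hqex : ∀ n, ∃ j, n < e (j + 1) := fun n => ⟨n, (hmono.le_apply (x := n + 1))⟩
  let q : ℕ → ℕ := fun n => Nat.find (hqex n)
  have hq1 : ∀ n, n < e (q n + 1) := fun n => Nat.find_spec (hqex n)
  have hq2 : ∀ n, e (q n) ≤ n := by
    intro n
    rcases h : q n with _ | j
    · exact Nat.zero_le _
    · have := Nat.find_min (hqex n) (m := j) (by change j < q n; omega)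
      omega
  have hqmono : Monotone q := fun m n hmn => Nat.find_min' _ (hmn.trans_lt (hq1 n))
  obtain ⟨C₂, hC₂, hq⟩ := hU.selective q fun k => hU.notMem_of_finite
    ((Set.finite_Iio (e (k + 1))).subset fun n hn => by
      have h : q n = k := hn
      exact h ▸ hq1 n)
  -- points of one parity class lie in non-adjacent intervals
  obtain ⟨p, hp⟩ : ∃ p, {n | q n % 2 = p} ∈ U := by
    rcases U.em (fun n => q n % 2 = 0) with h | h
    · exact ⟨0, h⟩
    · exact ⟨1, mem_of_superset h fun n hn => by simpa using hn⟩
  refine ⟨C₁ ∩ C₂ ∩ {n | q n % 2 = p}, inter_mem (inter_mem hC₁ hC₂) hp, ?_⟩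
  rintro m ⟨⟨-, hm2⟩, hm3⟩ n ⟨⟨hn1, hn2⟩, hn3⟩ hmn
  have hlt : q m < q n := (hqmono hmn.le).lt_of_ne fun h => hmn.ne (hq hm2 hn2 h)
  have h2 : q m + 1 + 1 ≤ q n := by
    change q m % 2 = p at hm3
    change q n % 2 = p at hn3
    omega
  have h3 : b (e (q m + 1)) ≤ n :=
    (le_max_right _ _).trans ((he (q m + 1)).symm.le.trans ((hmono.monotone h2).trans (hq2 n)))
  exact hb _ n hn1 h3 m (hq1 m).le

/-- A construction in countably many steps, where in step `k`, in state `s`, `U`-almost every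
number `n` allows to pass to a new state, can be carried out so that the numbers used increase and
form a member of `U`. Only finitely many states can be reached by means of numbers below `m`, so
the numbers admissible in all of them form a member of `U`, and the diagonalization applies. -/
theorem IsSelectiveUltrafilter.exists_run {U : Ultrafilter ℕ} (hU : IsSelectiveUltrafilter U)
    {σ : Type*} (P : ℕ → σ → ℕ → σ → Prop) (h : ∀ k s, ∀ᶠ n in (U : Filter ℕ), ∃ s', P k s n s')
    (s₀ : σ) :
    ∃ (s : ℕ → σ) (n : ℕ → ℕ), s 0 = s₀ ∧ StrictMono n ∧ Set.range n ∈ U ∧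
      ∀ k, P k (s k) (n k) (s (k + 1)) := by
  classical
  choose! next hnext using fun k s n (h : ∃ s', P k s n s') => h
  -- the finitely many states that can be reached by moves `< m`
  let R : ℕ → Finset σ := fun m => Nat.rec {s₀}
    (fun m R => R ∪ (Finset.range (m + 1)).biUnion fun k => R.image fun s => next k s m) m
  have hR0 : R 0 = {s₀} := rfl
  have hR : ∀ m, R (m + 1) = R m ∪ (Finset.range (m + 1)).biUnion fun k =>
    (R m).image fun s => next k s m := fun _ => rfl
  have hRmono : Monotone R := monotone_nat_of_le_succ fun m => by
    rw [hR]; exact Finset.subset_union_left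
  let A : ℕ → Set ℕ := fun m => ⋂ k ∈ Finset.range (m + 2), ⋂ s ∈ R m, {n | ∃ s', P k s n s'}
  have hA : ∀ m, A m ∈ (U : Filter ℕ) := fun m =>
    (biInter_finset_mem _).2 fun k _ => (biInter_finset_mem _).2 fun s _ => h k s
  obtain ⟨C, hC, hCA⟩ := hU.exists_pairwise_mem (fun m => A (m + 1)) fun m => hA (m + 1)
  have hC' : C ∩ {n | ∃ s', P 0 s₀ n s'} ∈ U := inter_mem hC (h 0 s₀)
  set C' := C ∩ {n | ∃ s', P 0 s₀ n s'}
  have hinf : C'.Infinite := fun hfin => hU.notMem_of_finite hfin hC'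
  have hmono : StrictMono (Nat.nth (· ∈ C')) := Nat.nth_strictMono hinf
  have hmem : ∀ k, Nat.nth (· ∈ C') k ∈ C' := fun k => Nat.nth_mem_of_infinite hinf k
  set n := Nat.nth (· ∈ C')
  let s : ℕ → σ := fun k => Nat.rec s₀ (fun k s => next k s (n k)) k
  have hs : ∀ k, s (k + 1) = next k (s k) (n k) := fun _ => rfl
  have hsR : ∀ k, s k ∈ R (n k) ∧ s (k + 1) ∈ R (n k + 1) := by
    have hstep : ∀ k, s k ∈ R (n k) → s (k + 1) ∈ R (n k + 1) := by
      intro k hk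
      rw [hR, hs]
      refine Finset.mem_union_right _ (Finset.mem_biUnion.2 ⟨k, ?_, Finset.mem_image_of_mem _ hk⟩)
      exact Finset.mem_range.2 (Nat.lt_succ_of_le hmono.le_apply)
    intro k
    induction k with
    | zero =>
      have : s 0 ∈ R (n 0) := hRmono (Nat.zero_le _) (by simp [hR0, s])
      exact ⟨this, hstep 0 this⟩
    | succ k ih =>
      have : s (k + 1) ∈ R (n (k + 1)) := hRmono (hmono (Nat.lt_succ_self k)) ih.2
      exact ⟨this, hstep _ this⟩
  refine ⟨s, n, rfl, hmono, ?_, fun k => ?_⟩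
  · have hrange : Set.range n = C' := Nat.range_nth_of_infinite hinf
    rw [hrange]; exact hC'
  · rw [hs]
    refine hnext k (s k) (n k) ?_
    cases k with
    | zero => exact (hmem 0).2
    | succ k =>
      have := hCA _ (hmem k).1 _ (hmem (k + 1)).1 (hmono (Nat.lt_succ_self k))
      have := Set.mem_iInter₂.1 this (k + 1) (Finset.mem_range.2 (by
        have : k ≤ n k := hmono.le_apply
        omega))
      exact Set.mem_iInter₂.1 this _ (hsR k).2

/-! ### The limit homomorphism -/

/-- Homomorphisms to the circle that are altered by at most `2⁻ᵏ` in step `k`, on finite sets that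
exhaust the group, converge pointwise to a homomorphism. -/
theorem exists_addMonoidHom_dist_le_of_dist_succ_le {X : Type*} [AddCommGroup X]
    (φ : ℕ → X →+ UnitAddCircle) (F : ℕ → Finset X) (hF : Monotone F) (hex : ∀ x, ∃ k, x ∈ F k)
    (hφ : ∀ k, ∀ x ∈ F k, dist (φ k x) (φ (k + 1) x) ≤ (1 / 2) ^ k) :
    ∃ ψ : X →+ UnitAddCircle, ∀ k, ∀ x ∈ F k, dist (φ k x) (ψ x) ≤ 2 * (1 / 2) ^ k := by
  have hstep : ∀ k, ∀ x ∈ F k, ∀ j, dist (φ (j + k) x) (φ (j + 1 + k) x) ≤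
      2 * (1 / 2) ^ k / 2 / 2 ^ j := by
    intro k x hx j
    have := hφ (j + k) x (hF (Nat.le_add_left k j) hx)
    rw [Nat.add_right_comm j 1 k]
    refine this.trans (le_of_eq ?_)
    rw [pow_add]; simp only [one_div, inv_pow]; ring
  have hlim : ∀ x, ∃ t, Tendsto (fun k => φ k x) atTop (𝓝 t) := by
    intro x
    obtain ⟨k, hk⟩ := hex x
    obtain ⟨t, ht⟩ := cauchySeq_tendsto_of_complete (cauchySeq_of_le_geometric_two (hstep k x hk))
    exact ⟨t, (tendsto_add_atTop_iff_nat (f := fun j => φ j x) k).1 ht⟩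
  choose t ht using hlim
  refine ⟨⟨⟨t, ?_⟩, fun x y => ?_⟩, fun k x hx => ?_⟩
  · refine tendsto_nhds_unique (ht 0) ?_
    simp
  · refine tendsto_nhds_unique (ht (x + y)) ?_
    simpa using (ht x).add (ht y)
  · have := dist_le_of_le_geometric_two_of_tendsto₀ (hstep k x hx)
      ((tendsto_add_atTop_iff_nat (f := fun j => φ j x) k).2 (ht x))
    simpa using this

/-- The diagonal embedding of a group into its ultrapower. -/
noncomputable def germConst {X : Type*} [AddCommGroup X] (l : Filter ℕ) : X →+ Germ l X :=
  (Germ.coeAddHom l).comp (Pi.constAddMonoidHom ℕ X)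

/-- A single step of the construction. Here `L` is a retraction of the ultrapower onto the
constants and `θ` kills the constants. The homomorphism `φ` is altered little on `F`, so that at `y
n` it comes close to its value at the limit `L y`, while for some `m` in `B` its value at `h m`
comes close to the value at `L h` shifted by `θ h`. Both alterations exist because `φ ∘ L` and `φ ∘
L + θ` are homomorphisms on the ultrapower that extend `φ`. -/
theorem eventually_exists_step {X : Type*} [AddCommGroup X] [Module ℚ X]
    {U : Ultrafilter ℕ} (hU : (U : Filter ℕ) ≤ cofinite)
    (L : Germ (U : Filter ℕ) X →+ X) (hL : ∀ x, L (germConst _ x) = x)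
    (h : ℕ → X) (θ : Germ (U : Filter ℕ) X →+ UnitAddCircle) (hθ : ∀ x, θ (germConst _ x) = 0)
    {B : Set ℕ} (hB : B ∈ U) (φ : X →+ UnitAddCircle) (F : Finset X) (s : Finset (ℕ → X))
    (k : ℕ) {ε : ℝ} (hε : 0 < ε) :
    ∃ m ∈ B, k ≤ m ∧ ∀ᶠ n in (U : Filter ℕ), ∃ φ' : X →+ UnitAddCircle,
      (∀ f ∈ F, dist (φ f) (φ' f) ≤ ε) ∧
      (∀ y ∈ s, dist (φ' (y n)) (φ (L (y : Germ (U : Filter ℕ) X))) ≤ ε) ∧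
      dist (φ' (h m)) (φ (L (h : Germ (U : Filter ℕ) X)) + θ (h : Germ (U : Filter ℕ) X)) ≤ ε := by
  classical
  have hconst : ∀ x : X, ((fun _ => x : ℕ → X) : Germ (U : Filter ℕ) X) = germConst _ x :=
    fun _ => rfl
  have h1 := eventually_exists_addMonoidHom_dist_lt (φ.comp L + θ)
    (insert h ((F ∪ s.image fun y : ℕ → X => L (y : Germ (U : Filter ℕ) X)).image fun x _ => x))
    (half_pos hε)
  have hk : ∀ᶠ m in (U : Filter ℕ), k ≤ m := hU (by
    rw [Nat.cofinite_eq_atTop]; exact eventually_ge_atTop k)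
  obtain ⟨m, ⟨φ₁, hφ₁⟩, hmB, hkm⟩ :=
    (h1.and ((show ∀ᶠ m in (U : Filter ℕ), m ∈ B from hB).and hk)).exists
  have hφ₁h := hφ₁ h (Finset.mem_insert_self _ _)
  have hφ₁F : ∀ f ∈ F ∪ s.image fun y : ℕ → X => L (y : Germ (U : Filter ℕ) X),
      dist (φ₁ f) (φ f) < ε / 2 := by
    intro f hf
    have := hφ₁ _ (Finset.mem_insert_of_mem (Finset.mem_image_of_mem (fun x _ => x) hf))
    simpa [hconst, hL, hθ] using this
  refine ⟨m, hmB, hkm, ?_⟩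
  filter_upwards [eventually_exists_addMonoidHom_dist_lt (φ₁.comp L)
    (s ∪ (insert (h m) F).image fun x _ => x) (half_pos hε)] with n ⟨φ', hφ'⟩
  have hφ'F : ∀ f ∈ insert (h m) F, dist (φ' f) (φ₁ f) < ε / 2 := by
    intro f hf
    have := hφ' _ (Finset.mem_union_right _ (Finset.mem_image_of_mem (fun x _ => x) hf))
    simpa [hconst, hL] using this
  refine ⟨φ', fun f hf => ?_, fun y hy => ?_, ?_⟩
  · have a := hφ₁F f (Finset.mem_union_left _ hf)
    have b := hφ'F f (Finset.mem_insert_of_mem hf)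
    rw [dist_comm] at a b
    linarith [dist_triangle (φ f) (φ₁ f) (φ' f)]
  · have a := hφ' y (Finset.mem_union_left _ hy)
    have b := hφ₁F _ (Finset.mem_union_right _ (Finset.mem_image_of_mem _ hy))
    exact (dist_triangle _ _ _).trans ((add_lt_add a b).le.trans (add_halves ε).le)
  · have a := hφ'F _ (Finset.mem_insert_self _ _)
    exact (dist_triangle _ _ _).trans ((add_lt_add a hφ₁h).le.trans (add_halves ε).le)

/-- The limit of the construction: `φ ∘ y i` tends to `φ (L y)` along `U`, and `φ (h m)` comes
arbitrarily close to `φ (L h) + θ h` for infinitely many `m` in `B`. -/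
theorem exists_addMonoidHom_tendsto_and_frequently {U : Ultrafilter ℕ}
    (hU : IsSelectiveUltrafilter U) {X : Type*} [AddCommGroup X] [Module ℚ X] [Countable X]
    (L : Germ (U : Filter ℕ) X →+ X) (hL : ∀ x, L (germConst _ x) = x) (y : ℕ → ℕ → X)
    (h : ℕ → X) (θ : Germ (U : Filter ℕ) X →+ UnitAddCircle) (hθ : ∀ x, θ (germConst _ x) = 0)
    {B : Set ℕ} (hB : B ∈ U) :
    ∃ φ : X →+ UnitAddCircle,
      (∀ i, Tendsto (fun n => φ (y i n)) (U : Filter ℕ)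
        (𝓝 (φ (L (y i : Germ (U : Filter ℕ) X))))) ∧
      ∀ ε > 0, ∀ N, ∃ m ∈ B, N ≤ m ∧
        dist (φ (h m)) (φ (L (h : Germ (U : Filter ℕ) X)) + θ (h : Germ (U : Filter ℕ) X)) < ε := by
  classical
  obtain ⟨e, he⟩ := exists_surjective_nat X
  -- a state is a homomorphism together with the finite set on which it is to be nearly preserved
  let P : ℕ → (X →+ UnitAddCircle) × Finset X → ℕ → (X →+ UnitAddCircle) × Finset X → Prop :=
    fun k s n s' => s.2 ⊆ s'.2 ∧ e k ∈ s'.2 ∧ (∀ i < k, y i n ∈ s'.2) ∧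
      (∀ f ∈ s.2, dist (s.1 f) (s'.1 f) ≤ (1 / 2) ^ k) ∧
      (∀ i < k, dist (s'.1 (y i n)) (s.1 (L (y i : Germ (U : Filter ℕ) X))) ≤ (1 / 2) ^ k) ∧
      ∃ m ∈ B, k ≤ m ∧ h m ∈ s'.2 ∧ dist (s'.1 (h m))
        (s.1 (L (h : Germ (U : Filter ℕ) X)) + θ (h : Germ (U : Filter ℕ) X)) ≤ (1 / 2) ^ k
  have hP : ∀ k s, ∀ᶠ n in (U : Filter ℕ), ∃ s', P k s n s' := by
    rintro k ⟨φ, F⟩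
    obtain ⟨m, hm, hkm, hev⟩ := eventually_exists_step hU.le_cofinite L hL h θ hθ hB φ F
      ((Finset.range k).image y) k (ε := (1 / 2) ^ k) (by positivity)
    filter_upwards [hev] with n ⟨φ', h1, h2, h3⟩
    refine ⟨(φ', F ∪ {e k, h m} ∪ (Finset.range k).image fun i => y i n), ?_, ?_, ?_, h1, ?_,
      m, hm, hkm, ?_, h3⟩
    · exact Finset.subset_union_left.trans Finset.subset_union_left
    · simp
    · intro i hi
      exact Finset.mem_union_right _ (Finset.mem_image_of_mem _ (Finset.mem_range.2 hi))
    · intro i hi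
      exact h2 _ (Finset.mem_image_of_mem _ (Finset.mem_range.2 hi))
    · simp
  obtain ⟨s, n, -, hn, hnU, hs⟩ := hU.exists_run P hP (0, ∅)
  have hmono : Monotone fun k => (s k).2 := monotone_nat_of_le_succ fun k => (hs k).1
  obtain ⟨φ, hφ⟩ := exists_addMonoidHom_dist_le_of_dist_succ_le (fun k => (s k).1)
    (fun k => (s k).2) hmono (fun x => by
      obtain ⟨k, rfl⟩ := he x
      exact ⟨k + 1, (hs k).2.1⟩) (fun k => (hs k).2.2.2.1)
  have hmem : ∀ x, ∀ᶠ k in atTop, x ∈ (s k).2 := fun x => by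
    obtain ⟨k, rfl⟩ := he x
    exact eventually_atTop.2 ⟨k + 1, fun j hj => hmono hj (hs k).2.1⟩
  have hpow : ∀ k : ℕ, (2 : ℝ) * (1 / 2) ^ (k + 1) = (1 / 2) ^ k := fun k => by
    rw [pow_succ]; ring
  have hsmall : ∀ ε > 0, ∀ᶠ k : ℕ in atTop, 4 * (1 / 2 : ℝ) ^ k < ε := fun ε hε => by
    have : Tendsto (fun k : ℕ => 4 * (1 / 2 : ℝ) ^ k) atTop (𝓝 (4 * 0)) :=
      (tendsto_pow_atTop_nhds_zero_of_lt_one (by norm_num) (by norm_num)).const_mul 4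
    rw [mul_zero] at this
    exact this.eventually (gt_mem_nhds hε)
  refine ⟨φ, fun i => ?_, fun ε hε N => ?_⟩
  · have hlim : Tendsto (fun k => φ (y i (n k))) atTop
        (𝓝 (φ (L (y i : Germ (U : Filter ℕ) X)))) := by
      refine Metric.tendsto_nhds.2 fun ε hε => ?_
      filter_upwards [hsmall ε hε, hmem (L (y i : Germ (U : Filter ℕ) X)), eventually_gt_atTop i]
        with k hk hkL hik
      have h1 := hφ (k + 1) _ ((hs k).2.2.1 i hik)
      have h2 := hφ k _ hkL
      have h3 := (hs k).2.2.2.2.1 i hik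
      rw [hpow, dist_comm] at h1
      linarith [dist_triangle4 (φ (y i (n k))) ((s (k + 1)).1 (y i (n k)))
        ((s k).1 (L (y i : Germ (U : Filter ℕ) X))) (φ (L (y i : Germ (U : Filter ℕ) X)))]
    -- a set containing all but finitely many of the `n k` belongs to `U`
    intro V hV
    obtain ⟨K, hK⟩ := eventually_atTop.1 (hlim hV)
    have hfin : (n '' Set.Iio K)ᶜ ∈ (U : Filter ℕ) :=
      hU.le_cofinite ((Set.finite_Iio K).image n).compl_mem_cofinite
    rw [mem_map]
    filter_upwards [hnU, hfin]
    rintro _ ⟨k, rfl⟩ hk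
    exact hK k (not_lt.1 fun hlt => hk ⟨k, hlt, rfl⟩)
  · obtain ⟨k, hk, hkL, hNk⟩ := ((hsmall ε hε).and ((hmem (L (h : Germ (U : Filter ℕ) X))).and
      (eventually_ge_atTop N))).exists
    obtain ⟨m, hmB, hkm, hmF, hm⟩ := (hs k).2.2.2.2.2
    refine ⟨m, hmB, hNk.trans hkm, ?_⟩
    have h1 := hφ (k + 1) _ hmF
    have h2 := hφ k _ hkL
    rw [hpow, dist_comm] at h1
    rw [← dist_add_right _ _ (θ (h : Germ (U : Filter ℕ) X))] at h2
    linarith [dist_triangle4 (φ (h m)) ((s (k + 1)).1 (h m))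
      ((s k).1 (L (h : Germ (U : Filter ℕ) X)) + θ (h : Germ (U : Filter ℕ) X))
      (φ (L (h : Germ (U : Filter ℕ) X)) + θ (h : Germ (U : Filter ℕ) X))]

/-- For a retraction `L` of the ultrapower of a countable `ℚ`-vector space onto the constants, some
homomorphism `φ` to the circle has `φ (L y)` as the limit of `φ ∘ y` along `U`, for countably many
given sequences `y`, although `φ ∘ h` does not converge on `B` for a given `h` whose class is not
constant. -/
theorem exists_addMonoidHom_tendsto_and_not_tendsto {U : Ultrafilter ℕ}
    (hU : IsSelectiveUltrafilter U) {X : Type*} [AddCommGroup X] [Module ℚ X] [Countable X]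
    (L : Germ (U : Filter ℕ) X →+ X) (hL : ∀ x, L (germConst _ x) = x) {Y : Set (ℕ → X)}
    (hY : Y.Countable) {h : ℕ → X}
    (hh : ∀ x, (h : Germ (U : Filter ℕ) X) ≠ germConst _ x) {B : Set ℕ} (hB : B ∈ U) :
    ∃ φ : X →+ UnitAddCircle,
      (∀ y ∈ Y, Tendsto (fun n => φ (y n)) (U : Filter ℕ)
        (𝓝 (φ (L (y : Germ (U : Filter ℕ) X))))) ∧
      ¬ ∃ z, Tendsto (fun n : B => φ (h n)) atTop (𝓝 z) := by
  obtain ⟨y, hy⟩ := (hY.insert h).exists_eq_range (Set.insert_nonempty h Y)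
  obtain ⟨ψ, hψ⟩ := exists_addMonoidHom_eq_half (sub_ne_zero.2 (hh (L h)))
  -- the projection `a ↦ a - L a` of the ultrapower kills the constants, but not the class of `h`
  obtain ⟨φ, hφ, hφh⟩ := exists_addMonoidHom_tendsto_and_frequently hU L hL y h
    (ψ.comp (AddMonoidHom.id _ - (germConst _).comp L)) (fun x => by simp [hL]) hB
  have hY' : ∀ y ∈ insert h Y, Tendsto (fun n => φ (y n)) (U : Filter ℕ)
      (𝓝 (φ (L (y : Germ (U : Filter ℕ) X)))) := by
    rw [hy]; rintro _ ⟨i, rfl⟩; exact hφ i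
  refine ⟨φ, fun y hy => hY' y (Set.mem_insert_of_mem _ hy), ?_⟩
  rintro ⟨z, hz⟩
  obtain ⟨b, hb⟩ := U.nonempty_of_mem hB
  have : Nonempty B := ⟨⟨b, hb⟩⟩
  obtain ⟨N, hN⟩ := Metric.tendsto_atTop.1 hz (1 / 8) (by norm_num)
  have hk : ∀ᶠ m in (U : Filter ℕ), (N : ℕ) ≤ m := hU.le_cofinite (by
    rw [Nat.cofinite_eq_atTop]; exact eventually_ge_atTop _)
  obtain ⟨n, hn, hnB, hNn⟩ := ((Metric.tendsto_nhds.1 (hY' h (Set.mem_insert _ _)) (1 / 8)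
    (by norm_num)).and ((show ∀ᶠ m in (U : Filter ℕ), m ∈ B from hB).and hk)).exists
  obtain ⟨m, hmB, hNm, hm⟩ := hφh (1 / 8) (by norm_num) N
  have h1 := hN ⟨n, hnB⟩ hNn
  have h2 := hN ⟨m, hmB⟩ hNm
  have hval : (ψ.comp (AddMonoidHom.id _ - (germConst _).comp L)) (h : Germ (U : Filter ℕ) X) =
      ((1 / 2 : ℝ) : UnitAddCircle) := hψ
  rw [hval] at hm
  have hdist : dist (φ (L (h : Germ (U : Filter ℕ) X)))
      (φ (L (h : Germ (U : Filter ℕ) X)) + ((1 / 2 : ℝ) : UnitAddCircle)) = 1 / 2 := by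
    rw [dist_eq_norm, sub_add_cancel_left, norm_neg, UnitAddCircle.norm_eq, round_eq]
    norm_num
  rw [dist_comm] at hn
  have h3 := dist_triangle4 (φ (L (h : Germ (U : Filter ℕ) X))) (φ (h n)) z (φ (h m))
  have h4 := dist_triangle (φ (L (h : Germ (U : Filter ℕ) X))) (φ (h m))
    (φ (L (h : Germ (U : Filter ℕ) X)) + ((1 / 2 : ℝ) : UnitAddCircle))
  rw [dist_comm z] at h3
  linarith

/-! ### The ultrapower of the rational group -/

/-- The homomorphism of ultrapowers induced by a homomorphism of groups. -/
noncomputable def germMap {X Y : Type*} [AddCommGroup X] [AddCommGroup Y] (l : Filter ℕ)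
    (f : X →+ Y) : Germ l X →+ Germ l Y :=
  AddMonoidHom.mk' (Germ.map f) fun a b => a.inductionOn₂ b fun a b => by
    rw [← Germ.coe_add, Germ.map_coe, Germ.map_coe, Germ.map_coe, ← Germ.coe_add]
    congr 1; ext; simp

theorem ultClass_sum_smul (U : Ultrafilter ℕ) {κ : Cardinal.{u}} {ι : Type*} (s : Finset ι)
    (r : ι → ℚ) (g : ι → ℕ → RatSum κ) :
    ultClass U (fun n => ∑ i ∈ s, r i • g i n) = ∑ i ∈ s, r i • ultClass U (g i) := by
  have h : (fun n => ∑ i ∈ s, r i • g i n) = ∑ i ∈ s, r i • g i := by ext n; simp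
  rw [h]
  change Germ.coeAddHom (U : Filter ℕ) _ = _
  rw [map_sum]; rfl

/-- The class of a constant sequence is a combination of the classes of the constants `χ_μ`. -/
theorem ultClass_const (U : Ultrafilter ℕ) {κ : Cardinal.{u}} (x : RatSum κ) :
    ultClass U (fun _ => x) =
      Finsupp.linearCombination ℚ (fun μ => ultClass U fun _ => chi μ) x := by
  have hx : x = ∑ μ ∈ x.support, x μ • chi μ := by
    conv_lhs => rw [← Finsupp.sum_single x]
    simp [Finsupp.sum, chi]
  conv_lhs => rw [hx]
  exact ultClass_sum_smul U x.support x fun μ _ => chi μ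

theorem mainTheorem3
    (κ : Cardinal.{u})
    (U : Ultrafilter ℕ) (hU : IsSelectiveUltrafilter U)
    (H : Set (ℕ → RatSum κ)) (hH : IsUltBasis U H)
    (𝒢 : Set (ℕ → RatSum κ)) (h𝒢H : 𝒢 ⊆ H) (h𝒢 : 𝒢.Countable)
    (B : Set ℕ) (hB : B ∈ U)
    (H' : Finset 𝒢) (r : 𝒢 → ℚ) (hr : ∃ g ∈ H', r g ≠ 0)
    (E : Set (Below κ)) (hEc : E.Countable) (hEi : E.Infinite)
    (hωE : Set.Iio Ordinal.omega0 ⊆ Subtype.val '' E)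
    (hE : ∀ (g : 𝒢) (n : ℕ), ((g.1 n).support : Set (Below κ)) ⊆ E)
    (ξ : 𝒢 → Below κ) (hξE : ∀ g, ξ g ∈ E)
    (hξc : ∀ g, (ξ g).1 < Cardinal.continuum.ord) :
    ∃ φ : Finsupp.supported ℚ ℚ E →+ UnitAddCircle,
      (∀ (g : 𝒢) (N : ℕ), 0 < N →
        Tendsto (fun n : ℕ => φ ⟨(1 / (N : ℚ)) • g.1 n, smul_mem_supported (hE g n) _⟩)
          (U : Filter ℕ)
          (𝓝 (φ ⟨(1 / (N : ℚ)) • chi (ξ g), smul_chi_mem_supported (hξE g) _⟩))) ∧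
      ¬ ∃ z : UnitAddCircle,
        Tendsto
          (fun n : B => φ ⟨∑ g ∈ H', r g • g.1 (n : ℕ),
            sum_smul_mem_supported H' r (fun g : 𝒢 => g.1 (n : ℕ)) (fun g => hE g n)⟩)
          atTop (𝓝 z) := by
  classical
  have : Countable E := hEc
  have : Countable 𝒢 := h𝒢
  have : Countable (Finsupp.supported ℚ ℚ E) :=
    (Finsupp.supportedEquivFinsupp (R := ℚ) (M := ℚ) E).injective.countable
  let b := Module.Basis.mk hH.1 hH.2.ge
  have hbg : ∀ g : H, b (Sum.inl g) = ultClass U g := fun g => Module.Basis.mk_apply _ _ _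
  have hbμ : ∀ μ, b (Sum.inr μ) = ultClass U fun _ => chi μ := fun μ => Module.Basis.mk_apply _ _ _
  -- `Λ` fixes the constants and sends the class of `g ∈ 𝒢` to `χ_{ξ g}`; its other values are
  -- irrelevant
  let Λ : Ult U κ →ₗ[ℚ] RatSum κ := b.constr ℚ (Sum.elim
    (fun g => if hg : g.1 ∈ 𝒢 then chi (ξ ⟨g.1, hg⟩) else 0) chi)
  have hΛg : ∀ g : 𝒢, Λ (ultClass U g) = chi (ξ g) := fun g => by
    rw [← hbg ⟨g.1, h𝒢H g.2⟩, Module.Basis.constr_basis]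
    simp
  have hΛconst : ∀ x, Λ (ultClass U fun _ => x) = x := fun x => by
    rw [ultClass_const, Finsupp.apply_linearCombination]
    have : (Λ ∘ fun μ => ultClass U fun _ => chi μ) = chi := by
      funext μ
      simp only [Function.comp_apply]
      rw [← hbμ, Module.Basis.constr_basis]; rfl
    rw [this, Finsupp.linearCombination_apply]
    simp [chi]
  -- `Λ` need not map the ultrapower of `ℚ^(E)` into `ℚ^(E)`, so it is followed by the restriction
  -- of functions to `E`
  let L : Germ (U : Filter ℕ) (Finsupp.supported ℚ ℚ E) →+ Finsupp.supported ℚ ℚ E :=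
    (Finsupp.restrictDom ℚ ℚ E).toAddMonoidHom.comp
      (Λ.toAddMonoidHom.comp (germMap _ (Finsupp.supported ℚ ℚ E).subtype.toAddMonoidHom))
  have hLcoe : ∀ y : ℕ → Finsupp.supported ℚ ℚ E,
      L (y : Germ (U : Filter ℕ) (Finsupp.supported ℚ ℚ E)) =
        Finsupp.restrictDom ℚ ℚ E (Λ (ultClass U fun n => (y n : RatSum κ))) := fun _ => rfl
  have hrestrict : ∀ x : Finsupp.supported ℚ ℚ E, Finsupp.restrictDom ℚ ℚ E (x : RatSum κ) = x :=
    fun x => LinearMap.congr_fun (Finsupp.restrictDom_comp_subtype E) x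
  have hL : ∀ x, L (germConst _ x) = x := fun x => by
    refine (hLcoe fun _ => x).trans ?_
    rw [hΛconst, hrestrict]
  let h : ℕ → Finsupp.supported ℚ ℚ E := fun n => ⟨∑ g ∈ H', r g • g.1 n,
    sum_smul_mem_supported H' r (fun g : 𝒢 => g.1 n) (fun g => hE g n)⟩
  have hh : ∀ x, (h : Germ (U : Filter ℕ) (Finsupp.supported ℚ ℚ E)) ≠ germConst _ x := by
    intro x hx
    obtain ⟨g₀, hg₀, hr₀⟩ := hr
    have hx' : ultClass U (fun n => ∑ g ∈ H', r g • g.1 n) = ultClass U fun _ => (x : RatSum κ) :=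
      congrArg (germMap (U : Filter ℕ) (Finsupp.supported ℚ ℚ E).subtype.toAddMonoidHom) hx
    rw [ultClass_sum_smul U H' r fun g => g.1, ultClass_const] at hx'
    -- the coordinate of `h` at `g₀` is `r g₀`, and that of a constant is `0`
    have hcoord := congrArg (b.coord (Sum.inl ⟨g₀.1, h𝒢H g₀.2⟩)) hx'
    have hr' : (b.coord (Sum.inl ⟨g₀.1, h𝒢H g₀.2⟩)) ∘ (fun μ => ultClass U fun _ => chi μ) = 0 := by
      funext μ
      simp only [Function.comp_apply]
      rw [← hbμ]; simp
    rw [Finsupp.apply_linearCombination, hr', map_sum, Finset.sum_eq_single g₀] at hcoord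
    · rw [map_smul, ← hbg ⟨g₀.1, h𝒢H g₀.2⟩] at hcoord
      exact hr₀ (by simpa using hcoord)
    · intro g _ hg
      rw [map_smul, ← hbg ⟨g.1, h𝒢H g.2⟩]
      have : g.1 ≠ g₀.1 := fun h => hg (Subtype.ext h)
      simp [this]
    · exact fun h => absurd hg₀ h
  let y : 𝒢 × ℕ → ℕ → Finsupp.supported ℚ ℚ E := fun p n =>
    ⟨(1 / (p.2 : ℚ)) • p.1.1 n, smul_mem_supported (hE p.1 n) _⟩
  have hLy : ∀ p, L (y p : Germ (U : Filter ℕ) (Finsupp.supported ℚ ℚ E)) =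
      ⟨(1 / (p.2 : ℚ)) • chi (ξ p.1), smul_chi_mem_supported (hξE p.1) _⟩ := by
    intro p
    rw [hLcoe]
    have : (ultClass U fun n => (y p n : RatSum κ)) = (1 / (p.2 : ℚ)) • ultClass U p.1.1 := rfl
    rw [this, map_smul, hΛg]
    exact hrestrict ⟨_, smul_chi_mem_supported (hξE p.1) _⟩
  obtain ⟨φ, hφ, hφh⟩ := exists_addMonoidHom_tendsto_and_not_tendsto hU L hL
    (Set.countable_range y) hh hB
  refine ⟨φ, fun g N _ => ?_, hφh⟩
  have := hφ (y (g, N)) ⟨_, rfl⟩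
  rwa [hLy] at this
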